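/- Let $d\ge 2$ be an integer, and let $X=\omega\cdot d+1$ be equipped with its order topology. Let $M=\{\omega\cdot k : 1\le k\le d\}\subset X$ be the set of points of maximal rank, and let $N=X\smallsetminus M$ be the set of isolated points of $X$. Equip the group $\mathrm{Homeo}(X)$ with the permutation topology, generated by the sets $\{h : h(A)=B\}$ with $A,B\subset X$ clopen (this is the compact-open topology). Let $\mathrm F_{0,d}$ be the subgroup of the homeomorphisms that move only finitely many points of $N$, and let $\overline{\mathrm F}_{0,d}$ be its closure in $\mathrm{Homeo}(X)$. For $Z\subset M$, let $\mathrm F_Z$ be the subgroup of those $f\in\overline{\mathrm F}_{0,d}$ that restrict to the identity on an open neighborhood of each point of $Z$. For a subgroup $\Gamma$ of $\overline{\mathrm F}_{0,d}$, let $Z_\Gamma$ be the set of all $\mu\in M$ such that every $g\in\Gamma$ fixes pointwise some open neighborhood of $\mu$ (depending on $g$); for $f\in\overline{\mathrm F}_{0,d}$, write $Z_f=Z_{\langle f\rangle}$. An element $g$ of a group $G$ uniformly normally generates $G$ if there is $k\in\mathbb N$ such that every element of $G$ is a product of at most $k$ conjugates in $G$ of $g$ and $g^{-1}$. Theorem.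 Let $\Gamma$ be a normal subgroup of $\overline{\mathrm F}_{0,d}$ that is not contained in $\mathrm F_{0,d}$. Then $\mathrm F_{Z_\Gamma}=\Gamma$. Moreover, (1) there exists $\gamma\in\Gamma$ such that $Z_\gamma=Z_\Gamma$, and (2) if $\gamma\in\Gamma$ satisfies $Z_\gamma=Z_\Gamma$, then $\gamma$ uniformly normally generates $\Gamma$. -/

import Mathlib

open Topology
open scoped Ordinal

namespace OrdHomeo

/-- The ordinal `ω · d + 1`, i.e. the set of ordinals below it; as an initial segment of the
ordinals its subspace topology is its order topology. -/
abbrev X (d : ℕ) : Type 1 := Set.Iio (ω * (d : Ordinal.{0}) + 1)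

/-- The group of homeomorphisms of `ω · d + 1` (the product is composition). -/
abbrev H (d : ℕ) : Type 1 := X d ≃ₜ X d

/-- The set of maximal rank points `ω · k`, `1 ≤ k ≤ d`. -/
def M (d : ℕ) : Set (X d) := {x | ∃ k : ℕ, 1 ≤ k ∧ k ≤ d ∧ (x : Ordinal.{0}) = ω * (k : Ordinal.{0})}

/-- The set of points of next-to-maximal rank, that is, the isolated points. -/
def N (d : ℕ) : Set (X d) := {x | IsOpen {x}}

/-- The subgroup of the homeomorphisms that induce a finite permutation on `N d`. -/
def F (d : ℕ) : Subgroup (H d) where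
  carrier := {h | {x | x ∈ N d ∧ h x ≠ x}.Finite}
  one_mem' := by simp
  mul_mem' := by
    intro f g hf hg
    refine (Set.Finite.union hf hg).subset ?_
    rintro x ⟨hx, hne⟩
    by_cases hgx : g x = x
    · refine Or.inl ⟨hx, fun h => hne ?_⟩
      rw [Homeomorph.mul_apply, hgx, h]
    · exact Or.inr ⟨hx, hgx⟩
  inv_mem' := by
    intro f hf
    refine Set.Finite.subset hf ?_
    rintro x ⟨hx, hne⟩
    refine ⟨hx, fun h => hne ?_⟩
    exact f.injective ((f.apply_symm_apply x).trans h.symm)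

/-- The permutation topology on the homeomorphism group: it is generated by the sets
`{h | h(A) = B}` with `A`, `B` clopen. -/
instance permutationTopology (d : ℕ) : TopologicalSpace (H d) :=
  TopologicalSpace.generateFrom
    {S | ∃ A B : Set (X d), IsClopen A ∧ IsClopen B ∧ S = {h : H d | h '' A = B}}

theorem isOpen_basic {d : ℕ} {A B : Set (X d)} (hA : IsClopen A) (hB : IsClopen B) :
    IsOpen {h : H d | h '' A = B} :=
  TopologicalSpace.isOpen_generateFrom_of_mem ⟨A, B, hA, hB, rfl⟩

instance isTopologicalGroup (d : ℕ) : IsTopologicalGroup (H d) where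
  continuous_mul := by
    refine continuous_generateFrom_iff.2 ?_
    rintro _ ⟨A, B, hA, hB, rfl⟩
    refine isOpen_iff_mem_nhds.2 ?_
    rintro ⟨f, g⟩ hfg
    have hC : IsClopen (g '' A) :=
      ⟨g.isClosedMap _ hA.1, g.isOpenMap _ hA.2⟩
    have hfg' : f '' (g '' A) = B := by
      rw [← Set.image_comp]; exact hfg
    refine Filter.mem_of_superset
      (prod_mem_nhds ((isOpen_basic hC hB).mem_nhds hfg') ((isOpen_basic hA hC).mem_nhds rfl)) ?_
    rintro ⟨f', g'⟩ ⟨h1, h2⟩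
    change (f' ∘ g') '' A = B
    have h1' : f' '' (g '' A) = B := h1
    have h2' : g' '' A = g '' A := h2
    rw [Set.image_comp, h2', h1']
  continuous_inv := by
    refine continuous_generateFrom_iff.2 ?_
    rintro _ ⟨A, B, hA, hB, rfl⟩
    convert isOpen_basic hB hA using 1
    ext f
    change f.symm '' A = B ↔ f '' B = A
    constructor
    · rintro rfl
      rw [← Set.image_comp]; simp
    · rintro rfl
      rw [← Set.image_comp]; simp

/-- The closure of `F d` in the homeomorphism group. -/
def Fbar (d : ℕ) : Subgroup (H d) := (F d).topologicalClosure

/-- `FZ Z` is the subgroup of the elements of `Fbar d` that restrict to the identity in an open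
neighborhood of each point of `Z`. -/
def FZ {d : ℕ} (Z : Set (X d)) : Subgroup (Fbar d) where
  carrier := {f | ∀ μ ∈ Z, ∃ U : Set (X d), IsOpen U ∧ μ ∈ U ∧ ∀ x ∈ U, (f : H d) x = x}
  one_mem' := fun μ _ => ⟨Set.univ, isOpen_univ, trivial, fun _ _ => rfl⟩
  mul_mem' := by
    intro f g hf hg μ hμ
    obtain ⟨U, hU, hμU, hfU⟩ := hf μ hμ
    obtain ⟨V, hV, hμV, hgV⟩ := hg μ hμ
    refine ⟨U ∩ V, hU.inter hV, ⟨hμU, hμV⟩, fun x hx => ?_⟩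
    change (f : H d) ((g : H d) x) = x
    rw [hgV x hx.2, hfU x hx.1]
  inv_mem' := by
    intro f hf μ hμ
    obtain ⟨U, hU, hμU, hfU⟩ := hf μ hμ
    refine ⟨U, hU, hμU, fun x hx => ?_⟩
    exact (f : H d).injective (((f : H d).apply_symm_apply x).trans (hfU x hx).symm)

/-- `ZΓ Γ` is the set of the `μ ∈ M d` such that each element of `Γ` fixes some open neighborhood
of `μ` pointwise. -/
def ZΓ {d : ℕ} (Γ : Subgroup (Fbar d)) : Set (X d) :=
  {μ | μ ∈ M d ∧ ∀ g ∈ Γ, ∃ U : Set (X d), IsOpen U ∧ μ ∈ U ∧ ∀ x ∈ U, (g : H d) x = x}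

/-- An element `g` uniformly normally generates the group `G` if for some `k` every element of `G`
is a product of at most `k` conjugates (in `G`) of `g` and `g⁻¹`. -/
def UniformlyNormallyGenerates {G : Type*} [Group G] (g : G) : Prop :=
  ∃ k : ℕ, ∀ x : G, ∃ l : List G,
    l.length ≤ k ∧ (∀ y ∈ l, ∃ c : G, y = c * g * c⁻¹ ∨ y = c * g⁻¹ * c⁻¹) ∧ l.prod = x

end OrdHomeo

/-! Around each `μ` in `M d` there is a clopen set containing no other point of `M d`; it is `μ`
together with isolated points converging to it. Any permutation of these isolated points is a
homeomorphism (`continuous_of_suppIn`), and even a limit of finitary ones (`mem_Fbar_of_suppIn`).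
Conversely, elements of `Fbar d` fix `M d` pointwise and, after removal of one such local factor at
each point of `M d`, move only finitely many points (`exists_isLocalAt_fixesNear_mul_inv`,
`induction_isLocalAt`).

An element `g` that is not the identity near `μ` moves infinitely many isolated points there. Every
local element at `μ` is then a product of eight conjugates of `g` and `g⁻¹` (`conjProd_of_suppIn`):
split it into two permutations of coinfinite support, conjugate each into a set displaced by `g`,
and write it there as a commutator by a shift trick. Hence a normal `Γ` contains everything local at
each `μ` outside `ZΓ Γ`. Such a `μ` exists because `Γ` is not finitary, and the finite remainder
counts as local at it. The number of factors is bounded, so generation is uniform. -/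

namespace OrdHomeo

/-! ### Permutations of countable sets and products of conjugates. -/

section Permutations

open Equiv

/-- The permutation `p` is supported in the set `B`. -/
def SuppIn {α : Type*} (p : Perm α) (B : Set α) : Prop := ∀ x, x ∉ B → p x = x

theorem SuppIn.mono {α : Type*} {p : Perm α} {B C : Set α} (h : SuppIn p B) (hBC : B ⊆ C) :
    SuppIn p C := fun x hx => h x fun hB => hx (hBC hB)

theorem SuppIn.mul {α : Type*} {p q : Perm α} {B : Set α} (hp : SuppIn p B) (hq : SuppIn q B) :
    SuppIn (p * q) B := fun x hx => by rw [Perm.mul_apply, hq x hx, hp x hx]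

theorem SuppIn.inv {α : Type*} {p : Perm α} {B : Set α} (hp : SuppIn p B) : SuppIn p⁻¹ B :=
  fun x hx => by rw [Perm.inv_eq_iff_eq, hp x hx]

theorem SuppIn.apply_mem {α : Type*} {p : Perm α} {B : Set α} (hp : SuppIn p B) {x : α}
    (hx : x ∈ B) : p x ∈ B := by
  by_contra h
  have := p.injective (hp _ h)
  rw [this] at h
  exact h hx

theorem suppIn_viaEmbedding {α β : Type*} (p : Perm α) (e : α ↪ β) {B : Set β}
    (h : Set.range e ⊆ B) : SuppIn (p.viaEmbedding e) B :=
  fun x hx => p.viaEmbedding_apply_of_notMem e x fun hx' => hx (h hx')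

theorem SuppIn.commute {α : Type*} {p q : Perm α} {B C : Set α} (hp : SuppIn p B)
    (hq : SuppIn q C) (h : Disjoint B C) : p * q = q * p := by
  ext x
  simp only [Perm.mul_apply]
  by_cases hB : x ∈ B
  · rw [hq x (Set.disjoint_left.1 h hB), hq _ (Set.disjoint_left.1 h (hp.apply_mem hB))]
  · rw [hp x hB]
    by_cases hC : x ∈ C
    · rw [hp _ (Set.disjoint_right.1 h (hq.apply_mem hC))]
    · rw [hq x hC, hp x hB]

theorem SuppIn.conj {α : Type*} {p : Perm α} {B : Set α} (hp : SuppIn p B) (c : Perm α) :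
    SuppIn (c * p * c⁻¹) (c '' B) := by
  intro x hx
  have : c⁻¹ x ∉ B := fun h => hx ⟨_, h, by simp⟩
  rw [Perm.mul_apply, Perm.mul_apply, hp _ this]
  exact c.apply_symm_apply x

/-- `x` is a product of at most `k` conjugates of `g` and `g⁻¹`. -/
def ConjProd {G : Type*} [Group G] (g : G) (k : ℕ) (x : G) : Prop :=
  ∃ l : List G,
    l.length ≤ k ∧ (∀ y ∈ l, ∃ c : G, y = c * g * c⁻¹ ∨ y = c * g⁻¹ * c⁻¹) ∧ l.prod = x

namespace ConjProd

variable {G : Type*} [Group G] {g x y : G} {k m : ℕ}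

theorem self : ConjProd g 1 g := ⟨[g], by simp, by simpa using ⟨1, by simp⟩, by simp⟩

theorem mul (hx : ConjProd g k x) (hy : ConjProd g m y) : ConjProd g (k + m) (x * y) := by
  obtain ⟨l, h1, h2, rfl⟩ := hx
  obtain ⟨l', h1', h2', rfl⟩ := hy
  refine ⟨l ++ l', by simp; omega, ?_, by simp⟩
  intro y hy
  rcases List.mem_append.1 hy with h | h
  · exact h2 y h
  · exact h2' y h

theorem conj (hx : ConjProd g k x) (c : G) : ConjProd g k (c * x * c⁻¹) := by
  obtain ⟨l, h1, h2, rfl⟩ := hx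
  refine ⟨l.map (MulAut.conj c), by simpa using h1, ?_, ?_⟩
  · intro y hy
    obtain ⟨z, hz, rfl⟩ := List.mem_map.1 hy
    obtain ⟨b, hb⟩ := h2 z hz
    refine ⟨c * b, ?_⟩
    rcases hb with rfl | rfl
    · left; simp [mul_assoc]
    · right; simp [mul_assoc]
  · rw [← map_list_prod]; simp

theorem inv (hx : ConjProd g k x) : ConjProd g k x⁻¹ := by
  obtain ⟨l, h1, h2, rfl⟩ := hx
  refine ⟨(l.map (·⁻¹)).reverse, by simpa using h1, ?_, (List.prod_inv_reverse l).symm⟩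
  intro y hy
  obtain ⟨z, hz, rfl⟩ := List.mem_map.1 (List.mem_reverse.1 hy)
  obtain ⟨b, hb⟩ := h2 z hz
  refine ⟨b, ?_⟩
  rcases hb with rfl | rfl
  · right; simp [mul_assoc]
  · left; simp [mul_assoc]

theorem mem_of_normal {Γ : Subgroup G} (hN : Γ.Normal) (hg : g ∈ Γ) (hx : ConjProd g k x) :
    x ∈ Γ := by
  obtain ⟨l, -, h2, rfl⟩ := hx
  refine Subgroup.list_prod_mem _ fun y hy => ?_
  obtain ⟨c, rfl | rfl⟩ := h2 y hy
  · exact hN.conj_mem _ hg c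
  · exact hN.conj_mem _ (inv_mem hg) c

end ConjProd

theorem exists_infinite_split {α : Type*} {S : Set α} (hS : S.Infinite) :
    ∃ T ⊆ S, T.Infinite ∧ (S \ T).Infinite := by
  let e := hS.natEmbedding
  have he : Function.Injective fun n => (e n : α) := Subtype.val_injective.comp e.injective
  refine ⟨Set.range fun n => (e (2 * n) : α), ?_, ?_, ?_⟩
  · rintro _ ⟨n, rfl⟩; exact (e (2 * n)).2
  · exact Set.infinite_range_of_injective fun a b h => by have := he h; omega
  · refine (Set.infinite_range_of_injective (f := fun n => (e (2 * n + 1) : α))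
      fun a b h => by have := he h; omega).mono ?_
    rintro _ ⟨n, rfl⟩
    refine ⟨(e _).2, ?_⟩
    rintro ⟨m, h⟩
    have := he h
    omega

/-- An infinite set of points moved by a permutation contains an infinite subset that is disjoint
from its image. -/
theorem exists_infinite_disjoint_image {α : Type*} (p : Perm α) {S : Set α} (hS : S.Infinite)
    (hp : ∀ x ∈ S, p x ≠ x) : ∃ W ⊆ S, W.Infinite ∧ Disjoint (p '' W) W := by
  obtain ⟨W, hW⟩ := zorn_subset {W : Set α | W ⊆ S ∧ ∀ x ∈ W, ∀ y ∈ W, p x ≠ y} (by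
    intro c hc hchain
    refine ⟨⋃₀ c, ⟨Set.sUnion_subset fun s hs => (hc hs).1, ?_⟩,
      fun s hs => Set.subset_sUnion_of_mem hs⟩
    rintro x ⟨s, hs, hx⟩ y ⟨t, ht, hy⟩
    rcases hchain.total hs ht with h | h
    · exact (hc ht).2 x (h hx) y hy
    · exact (hc hs).2 x hx y (h hy))
  refine ⟨W, hW.prop.1, fun hfin => hS ?_, ?_⟩
  -- By maximality, every point of `S` lies in `W`, `p '' W` or the preimage of `W`; otherwise it
  -- could be added to `W`.
  · refine ((hfin.union (hfin.image p)).union (hfin.image p.symm)).subset fun x hx => ?_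
    by_contra hcon
    simp only [Set.mem_union, not_or] at hcon
    obtain ⟨⟨h1, h2⟩, h3⟩ := hcon
    refine h1 (hW.le_of_ge (y := insert x W) ⟨Set.insert_subset hx hW.prop.1, ?_⟩
      (Set.subset_insert x W) (Set.mem_insert x W))
    rintro a (rfl | ha) b (rfl | hb)
    · exact hp _ hx
    · rintro rfl; exact h3 ⟨_, hb, by simp⟩
    · rintro rfl; exact h2 ⟨_, ha, rfl⟩
    · exact hW.prop.2 a ha b hb
  · rw [Set.disjoint_left]
    rintro _ ⟨x, hx, rfl⟩ hy
    exact hW.prop.2 x hx _ hy rfl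

/-- An injection between coinfinite subsets of a countable set `B` extends to a permutation
supported in `B`. -/
theorem exists_perm_eqOn {α : Type*} {B S : Set α} (hB : B.Countable) (hSB : S ⊆ B) (f : α → α)
    (hf : Set.InjOn f S) (hfB : f '' S ⊆ B) (h1 : (B \ S).Infinite)
    (h2 : (B \ f '' S).Infinite) : ∃ c : Perm α, SuppIn c B ∧ Set.EqOn c f S := by
  classical
  have : Countable ↥(B \ S) := (hB.mono Set.sdiff_subset).to_subtype
  have : Countable ↥(B \ f '' S) := (hB.mono Set.sdiff_subset).to_subtype
  have : Infinite ↥(B \ S) := h1.to_subtype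
  have : Infinite ↥(B \ f '' S) := h2.to_subtype
  obtain ⟨e⟩ : Nonempty (↥(B \ S) ≃ ↥(B \ f '' S)) := nonempty_equiv_of_countable
  have bij : Set.BijOn (fun x => if hx : x ∈ B \ S then (e ⟨x, hx⟩ : α) else f x) B B := by
    refine ⟨fun x hx => ?_, fun x hx y hy hxy => ?_, fun y hy => ?_⟩
    · by_cases hxS : x ∈ S
      · simpa [hxS] using hfB ⟨x, hxS, rfl⟩
      · simpa [hxS, hx] using (e ⟨x, hx, hxS⟩).2.1
    · by_cases hxS : x ∈ S <;> by_cases hyS : y ∈ S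
      · simp only [Set.mem_sdiff, hxS, hyS, not_true_eq_false, and_false, dite_false] at hxy
        exact hf hxS hyS hxy
      · simp only [Set.mem_sdiff, hxS, hyS, hy, not_true_eq_false, not_false_eq_true, and_false,
          and_self, dite_false, dite_true] at hxy
        exact absurd ⟨x, hxS, hxy⟩ (e ⟨y, hy, hyS⟩).2.2
      · simp only [Set.mem_sdiff, hxS, hyS, hx, not_true_eq_false, not_false_eq_true, and_false,
          and_self, dite_false, dite_true] at hxy
        exact absurd ⟨y, hyS, hxy.symm⟩ (e ⟨x, hx, hxS⟩).2.2
      · simp only [Set.mem_sdiff, hxS, hyS, hx, hy, not_false_eq_true,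
          and_self, dite_true] at hxy
        simpa using e.injective (Subtype.ext hxy)
    · by_cases hyS : y ∈ f '' S
      · obtain ⟨x, hx, rfl⟩ := hyS
        exact ⟨x, hSB hx, by simp [hx]⟩
      · obtain ⟨x, hx⟩ := e.surjective ⟨y, hy, hyS⟩
        refine ⟨x, x.2.1, ?_⟩
        have hx2 : (x : α) ∈ B \ S := x.2
        simp only [hx2, dite_true, Subtype.coe_eta, hx]
  refine ⟨Perm.ofSubtype (bij.equiv _), fun x hx => Perm.ofSubtype_apply_of_not_mem _ hx,
    fun x hx => ?_⟩
  rw [Perm.ofSubtype_apply_of_mem _ (hSB hx)]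
  simp [Set.BijOn.equiv, hx]

theorem exists_eq_viaEmbedding {α β : Type*} (e : β ↪ α) {p : Perm α}
    (hp : SuppIn p (Set.range e)) : ∃ q : Perm β, p = q.viaEmbedding e := by
  have hp' := hp.inv
  choose q hq using fun b => hp.apply_mem (Set.mem_range_self b)
  choose r hr using fun b => hp'.apply_mem (Set.mem_range_self b)
  refine ⟨⟨q, r, fun b => e.injective ?_, fun b => e.injective ?_⟩, ?_⟩
  · rw [hr, hq]; simp
  · rw [hq, hr]; simp
  · ext x
    by_cases hx : x ∈ Set.range e
    · obtain ⟨b, rfl⟩ := hx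
      rw [Perm.viaEmbedding_apply]
      exact (hq b).symm
    · rw [hp x hx, Perm.viaEmbedding_apply_of_notMem _ _ _ hx]

/-- A permutation of the column `{0} × β` of `ℤ × β` is a commutator. -/
theorem exists_commutator_eq_prodExtendRight {β : Type*} (τ : Perm β) :
    ∃ a b : Perm (ℤ × β), a * b * a⁻¹ * b⁻¹ = Perm.prodExtendRight 0 τ := by
  -- `a` acts by `τ` on every column `n ≥ 0` and `b` shifts columns by one. Conjugating `a⁻¹` by `b`
  -- cancels `a` on all columns but column `0`.
  let a : Perm (ℤ × β) :=
    { toFun := fun x => (x.1, if 0 ≤ x.1 then τ x.2 else x.2)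
      invFun := fun x => (x.1, if 0 ≤ x.1 then τ⁻¹ x.2 else x.2)
      left_inv := fun x => by dsimp; split_ifs <;> simp
      right_inv := fun x => by dsimp; split_ifs <;> simp }
  let b : Perm (ℤ × β) := (Equiv.addRight (1 : ℤ)).prodCongr (Equiv.refl β)
  refine ⟨a, b, ?_⟩
  rw [mul_inv_eq_iff_eq_mul, mul_inv_eq_iff_eq_mul]
  ext1 ⟨n, x⟩
  have ha : ∀ n x, a (n, x) = (n, if 0 ≤ n then τ x else x) := fun _ _ => rfl
  have hb : ∀ n x, b (n, x) = (n + 1, x) := fun _ _ => rfl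
  simp only [Perm.mul_apply, ha, hb]
  rcases lt_trichotomy n (-1) with h | rfl | h
  · rw [Perm.prodExtendRight_apply_ne _ (by dsimp; omega), if_neg (by omega), if_neg (by omega)]
  · simp
  · rw [Perm.prodExtendRight_apply_ne _ (by dsimp; omega), if_pos (by omega), if_pos (by omega)]

/-- If `g` moves `W` off itself, the commutator of two permutations supported in `W` is a product
of four conjugates of `g` and `g⁻¹`. -/
theorem conjProd_commutator {α G : Type*} [Group G] (θ : G →* Perm α)
    (hθ : Function.Injective θ) (g a b : G) {W : Set α} (hW : Disjoint (θ g '' W) W)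
    (ha : SuppIn (θ a) W) (hb : SuppIn (θ b) W) : ConjProd g 4 (a * b * a⁻¹ * b⁻¹) := by
  -- The left factor lives on the image of `W` under `g`, hence commutes with `b`. So in `[a, g] * b
  -- * [a, g]⁻¹ * b⁻¹` the parts displaced by `g` cancel, leaving `[a, b]`.
  have hc : (g * a⁻¹ * g⁻¹) * b = b * (g * a⁻¹ * g⁻¹) := by
    apply hθ
    have h := (ha.inv.conj (θ g)).commute hb hW
    simpa using h
  have h1 : ConjProd g 2 (a * g * a⁻¹ * g⁻¹) := (ConjProd.self.conj a).mul ConjProd.self.inv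
  have h2 := h1.mul (h1.inv.conj b)
  convert h2 using 1
  have h3 : b * (g * a⁻¹ * g⁻¹)⁻¹ = (g * a⁻¹ * g⁻¹)⁻¹ * b := by
    rw [eq_inv_mul_iff_mul_eq, ← mul_assoc, hc, mul_inv_cancel_right]
  have h4 : (a * g * a⁻¹ * g⁻¹) = a * (g * a⁻¹ * g⁻¹) := by group
  rw [h4, mul_inv_rev, ← mul_assoc b, h3]
  group

/-- A permutation supported in `B` is a product of two whose supports are coinfinite in `B`. -/
theorem exists_mul_eq_of_suppIn {α : Type*} {B : Set α} (hB : B.Countable) (hinf : B.Infinite)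
    {p : Perm α} (hp : SuppIn p B) :
    ∃ q r : Perm α, ∃ S T : Set α, S ⊆ B ∧ T ⊆ B ∧ (B \ S).Infinite ∧ (B \ T).Infinite ∧
      SuppIn q S ∧ SuppIn r T ∧ q * r = p := by
  -- Half of `B`, called `P`, serves as `D` unless `p '' P` covers almost all of the other half. In
  -- that case keep only the points of `P` sent into half of that other half.
  obtain ⟨D, hDB, hD, hDp⟩ : ∃ D ⊆ B, D.Infinite ∧ (B \ (D ∪ p '' D)).Infinite := by
    obtain ⟨P, hPB, hP, hQ⟩ := exists_infinite_split hinf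
    by_cases h : ((B \ P) \ p '' P).Infinite
    · exact ⟨P, hPB, hP, by rwa [Set.sdiff_sdiff] at h⟩
    obtain ⟨Q, hQB, hQ1, hQ2⟩ := exists_infinite_split hQ
    refine ⟨P ∩ p ⁻¹' Q, Set.inter_subset_left.trans hPB, fun hfin => hQ1 ?_, hQ2.mono ?_⟩
    · refine ((hfin.image p).union (Set.not_infinite.1 h)).subset fun y hy => ?_
      by_cases hyP : y ∈ p '' P
      · obtain ⟨x, hx, rfl⟩ := hyP
        exact Or.inl ⟨x, ⟨hx, hy⟩, rfl⟩
      · exact Or.inr ⟨hQB hy, hyP⟩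
    · rintro y ⟨⟨hyB, hyP⟩, hyQ⟩
      refine ⟨hyB, ?_⟩
      rintro (h | ⟨x, hx, rfl⟩)
      · exact hyP h.1
      · exact hyQ hx.2
  -- `C` leaves room to extend `p` from `D` to a permutation `c`, while infinitely many points stay
  -- outside its support. Then `c⁻¹ * p` fixes `D`.
  obtain ⟨C, hC, hC1, hC2⟩ := exists_infinite_split hDp
  have hpD : p '' D ⊆ B := by
    rintro _ ⟨x, hx, rfl⟩; exact hp.apply_mem (hDB hx)
  have hS : D ∪ p '' D ∪ C ⊆ B :=
    Set.union_subset (Set.union_subset hDB hpD) (hC.trans Set.sdiff_subset)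
  obtain ⟨c, hc, hcD⟩ := exists_perm_eqOn (S := D) (hB.mono hS)
    (Set.subset_union_left.trans Set.subset_union_left) p p.injective.injOn
    (Set.subset_union_right.trans Set.subset_union_left)
    (hC1.mono fun x hx => ⟨Or.inr hx, fun h => (hC hx).2 (Or.inl h)⟩)
    (hC1.mono fun x hx => ⟨Or.inr hx, fun h => (hC hx).2 (Or.inr h)⟩)
  refine ⟨c, c⁻¹ * p, _, B \ D, hS, Set.sdiff_subset, ?_, ?_, hc, ?_, by simp⟩
  · rwa [Set.sdiff_sdiff] at hC2
  · rwa [Set.sdiff_sdiff_cancel_left hDB]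
  · intro x hx
    rw [Perm.mul_apply, Perm.inv_eq_iff_eq]
    by_cases hxB : x ∈ B
    · have hxD : x ∈ D := by by_contra h; exact hx ⟨hxB, h⟩
      exact (hcD hxD).symm
    · rw [hp x hxB, hc x fun h => hxB (hS h)]

/-- Coinfiniteness of `S` allows a conjugation that carries `S` into one column of a copy of `ℤ × ℕ`
inside a set displaced by `g`. There the conjugate of `x` is a commutator, so `conjProd_commutator`
applies. -/
theorem conjProd_of_suppIn_coinfinite {α G : Type*} [Group G] (θ : G →* Perm α)
    (hθ : Function.Injective θ) {B S : Set α} (hB : B.Countable)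
    (hsurj : ∀ p : Perm α, SuppIn p B → ∃ g : G, θ g = p) (g : G)
    (hg : {x ∈ B | θ g x ≠ x}.Infinite) (hSB : S ⊆ B) (hS : (B \ S).Infinite) (x : G)
    (hx : SuppIn (θ x) S) : ConjProd g 4 x := by
  obtain ⟨W, hWB, hW, hdisj⟩ := exists_infinite_disjoint_image (θ g) hg fun x hx => hx.2
  have hWB : W ⊆ B := fun x hx => (hWB hx).1
  obtain ⟨eq⟩ : Nonempty (ℤ × ℕ ≃ ℕ) := nonempty_equiv_of_countable
  let e : ℤ × ℕ ↪ α := (eq.toEmbedding.trans hW.natEmbedding).trans (Function.Embedding.subtype _)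
  have heW : Set.range e ⊆ W := by
    rintro _ ⟨n, rfl⟩; exact (hW.natEmbedding _ _).2
  have : Countable S := (hB.mono hSB).to_subtype
  obtain ⟨i, hi⟩ := exists_injective_nat S
  classical
  let f : α → α := fun x => if h : x ∈ S then e (0, i ⟨x, h⟩) else x
  have hf : ∀ x (h : x ∈ S), f x = e (0, i ⟨x, h⟩) := fun x h => by simp [f, h]
  obtain ⟨c, hcB, hc⟩ := exists_perm_eqOn hB hSB f
    (fun x hx y hy hxy => by
      rw [hf x hx, hf y hy] at hxy
      have := e.injective hxy
      simp only [Prod.mk.injEq, true_and] at this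
      simpa using hi this)
    (by
      rintro _ ⟨x, hx, rfl⟩
      rw [hf x hx]
      exact hWB (heW ⟨_, rfl⟩)) hS
    -- Column `1` witnesses that the image of `S`, which lies in column `0`, is coinfinite in `B`.
    ((Set.infinite_range_of_injective (f := fun n : ℕ => e (1, n))
      fun a b h => by simpa using e.injective h).mono (by
        rintro _ ⟨n, rfl⟩
        refine ⟨hWB (heW ⟨_, rfl⟩), ?_⟩
        rintro ⟨x, hx, h⟩
        rw [hf x hx] at h
        simpa using e.injective h))
  obtain ⟨c', hc'⟩ := hsurj c hcB
  let e0 : ℕ ↪ α := ⟨fun n => e (0, n), fun a b h => by simpa using e.injective h⟩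
  obtain ⟨τ, hτ⟩ := exists_eq_viaEmbedding e0 (p := θ (c' * x * c'⁻¹)) (by
    have h := hx.conj c
    rw [map_mul, map_mul, map_inv, hc']
    refine h.mono ?_
    rintro _ ⟨y, hy, rfl⟩
    rw [hc hy, hf y hy]
    exact ⟨_, rfl⟩)
  have hτ2 : τ.viaEmbedding e0 = (Perm.prodExtendRight (0 : ℤ) τ).viaEmbedding e := by
    ext y
    by_cases hy : y ∈ Set.range e
    · obtain ⟨⟨n, m⟩, rfl⟩ := hy
      rw [Perm.viaEmbedding_apply]
      by_cases hn : n = 0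
      · subst hn
        rw [Perm.prodExtendRight_apply_eq]
        exact Perm.viaEmbedding_apply τ e0 m
      · rw [Perm.prodExtendRight_apply_ne _ hn, Perm.viaEmbedding_apply_of_notMem]
        rintro ⟨k, hk⟩
        have := e.injective hk
        simp only [Prod.mk.injEq] at this
        exact hn this.1.symm
    · rw [Perm.viaEmbedding_apply_of_notMem _ _ _ hy, Perm.viaEmbedding_apply_of_notMem]
      rintro ⟨k, rfl⟩
      exact hy ⟨_, rfl⟩
  obtain ⟨a, b, hab⟩ := exists_commutator_eq_prodExtendRight τ
  have haW := suppIn_viaEmbedding a e heW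
  have hbW := suppIn_viaEmbedding b e heW
  obtain ⟨a', ha'⟩ := hsurj _ (haW.mono hWB)
  obtain ⟨b', hb'⟩ := hsurj _ (hbW.mono hWB)
  have key : c' * x * c'⁻¹ = a' * b' * a'⁻¹ * b'⁻¹ := by
    apply hθ
    rw [hτ, hτ2, ← hab]
    simp only [map_mul, map_inv, ha', hb', ← Perm.viaEmbeddingHom_apply]
  have h4 := conjProd_commutator θ hθ g a' b' hdisj (by rwa [ha']) (by rwa [hb'])
  rw [← key] at h4
  have h5 := h4.conj c'⁻¹
  convert h5 using 1
  group

/-- If `g` moves infinitely many points of the countable set `B`, every permutation supported in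
`B` is a product of eight conjugates of `g` and `g⁻¹`. -/
theorem conjProd_of_suppIn {α G : Type*} [Group G] (θ : G →* Perm α)
    (hθ : Function.Injective θ) {B : Set α} (hB : B.Countable)
    (hsurj : ∀ p : Perm α, SuppIn p B → ∃ g : G, θ g = p) (g : G)
    (hg : {x ∈ B | θ g x ≠ x}.Infinite) (x : G) (hx : SuppIn (θ x) B) : ConjProd g 8 x := by
  obtain ⟨q, r, S, T, hS, hT, hS', hT', hq, hr, hqr⟩ :=
    exists_mul_eq_of_suppIn hB (hg.mono fun x hx => hx.1) hx
  obtain ⟨q', rfl⟩ := hsurj q (hq.mono hS)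
  obtain ⟨r', rfl⟩ := hsurj r (hr.mono hT)
  rw [← map_mul] at hqr
  rw [← hθ hqr]
  exact (conjProd_of_suppIn_coinfinite θ hθ hB hsurj g hg hS hS' q' hq).mul
    (conjProd_of_suppIn_coinfinite θ hθ hB hsurj g hg hT hT' r' hr)

/-- A permutation supported in `B` agrees on any finite subset of `B` with one of finite support. -/
theorem exists_finite_perm_eqOn {α : Type*} {B E : Set α} (hE : E.Finite) (hEB : E ⊆ B)
    {p : Perm α} (hp : SuppIn p B) :
    ∃ (q : Perm α) (T : Set α), T.Finite ∧ T ⊆ B ∧ SuppIn q T ∧ Set.EqOn q p E := by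
  classical
  have hT : (E ∪ p '' E).Finite := hE.union (hE.image p)
  have hTB : E ∪ p '' E ⊆ B := Set.union_subset hEB (by
    rintro _ ⟨x, hx, rfl⟩; exact hp.apply_mem (hEB hx))
  have : Finite ↥(E ∪ p '' E) := hT
  have hsymm : ∀ x ∈ p '' E, p.symm x ∈ E := by
    rintro _ ⟨y, hy, rfl⟩; simpa using hy
  let f : {x : ↥(E ∪ p '' E) // (x : α) ∈ E} ≃ {x : ↥(E ∪ p '' E) // (x : α) ∈ p '' E} :=
    { toFun := fun x => ⟨⟨p x, Or.inr ⟨x, x.2, rfl⟩⟩, ⟨x, x.2, rfl⟩⟩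
      invFun := fun x => ⟨⟨p.symm x, Or.inl (hsymm _ x.2)⟩, hsymm _ x.2⟩
      left_inv := fun x => by simp
      right_inv := fun x => by simp }
  refine ⟨Perm.ofSubtype (Equiv.extendSubtype f), _, hT, hTB,
    fun x hx => Perm.ofSubtype_apply_of_not_mem _ hx, fun x hx => ?_⟩
  have hx' : x ∈ E ∪ p '' E := Or.inl hx
  rw [Perm.ofSubtype_apply_of_mem _ hx',
    Equiv.extendSubtype_apply_of_mem f ⟨x, Or.inl hx⟩ hx]
  rfl

end Permutations

/-! ### Topology of the space: isolated points and local clopen neighborhoods. -/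

section Space

variable {d : ℕ}

instance compactSpace_X (d : ℕ) : CompactSpace (X d) := by
  have h : Set.Iio (ω * (d : Ordinal.{0}) + 1) = Set.Icc 0 (ω * (d : Ordinal.{0})) := by
    ext x; simp
  rw [← isCompact_iff_compactSpace, h]
  exact isCompact_Icc

theorem countable_X (d : ℕ) : Countable (X d) := by
  rw [← Cardinal.mk_le_aleph0_iff, Cardinal.mk_Iio_ordinal]
  simp only [Ordinal.card_add, Ordinal.card_mul, Ordinal.card_omega0, Ordinal.card_nat,
    Ordinal.card_one, Cardinal.lift_le_aleph0]
  exact Cardinal.add_le_aleph0.2 ⟨(Cardinal.mul_le_max_of_aleph0_le_left le_rfl).trans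
    (by simp [Cardinal.natCast_le_aleph0]), Cardinal.one_le_aleph0⟩

theorem finite_M (d : ℕ) : (M d).Finite := by
  refine Set.Finite.of_finite_image (f := Subtype.val) ?_ Subtype.val_injective.injOn
  refine ((Set.finite_Iic d).image fun k : ℕ => ω * (k : Ordinal.{0})).subset ?_
  rintro _ ⟨x, ⟨k, -, hk, hx⟩, rfl⟩
  exact ⟨k, hk, hx.symm⟩

theorem isOpen_singleton_iff_notMem_M {x : X d} : IsOpen ({x} : Set (X d)) ↔ x ∉ M d := by
  have h1 : IsOpen ({x} : Set (X d)) ↔ IsOpen ({(x : Ordinal.{0})} : Set Ordinal.{0}) := by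
    rw [← Set.image_singleton]
    exact (isOpen_Iio.isOpenEmbedding_subtypeVal.isOpen_iff_image_isOpen)
  rw [h1, SuccOrder.isOpen_singleton_iff, not_iff_not, Ordinal.isSuccLimit_iff,
    Ordinal.isSuccPrelimit_iff_omega0_dvd]
  constructor
  · rintro ⟨h0, k, hk⟩
    have hx : (x : Ordinal.{0}) ≤ ω * (d : Ordinal.{0}) := Order.lt_add_one_iff.1 x.2
    rw [hk] at hx
    have hkd : k ≤ d := le_of_mul_le_mul_left hx Ordinal.omega0_pos
    obtain ⟨n, rfl⟩ := Ordinal.lt_omega0.1 (hkd.trans_lt (Ordinal.natCast_lt_omega0 d))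
    refine ⟨n, Nat.one_le_iff_ne_zero.2 ?_, by exact_mod_cast hkd, hk⟩
    rintro rfl
    simp at hk
    exact h0 hk
  · rintro ⟨k, h1, -, hk⟩
    rw [hk]
    refine ⟨mul_ne_zero Ordinal.omega0_ne_zero ?_, dvd_mul_right _ _⟩
    exact_mod_cast (by omega : k ≠ 0)

theorem mem_N_iff {x : X d} : x ∈ N d ↔ x ∉ M d := isOpen_singleton_iff_notMem_M

theorem isOpen_of_disjoint_M {S : Set (X d)} (h : Disjoint S (M d)) : IsOpen S := by
  rw [← Set.biUnion_of_singleton S]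
  exact isOpen_biUnion fun x hx => isOpen_singleton_iff_notMem_M.2 (Set.disjoint_left.1 h hx)

/-- `C` is compact and covered by its own singletons, which are open. -/
theorem finite_of_isClosed {C : Set (X d)} (hC : IsClosed C) (h : Disjoint C (M d)) :
    C.Finite := by
  obtain ⟨t, ht⟩ := hC.isCompact.elim_finite_subcover (fun x : C => ({(x : X d)} : Set (X d)))
    (fun x => isOpen_singleton_iff_notMem_M.2 (Set.disjoint_left.1 h x.2))
    (fun x hx => Set.mem_iUnion.2 ⟨⟨x, hx⟩, rfl⟩)
  exact (t.finite_toSet.biUnion fun x _ => Set.finite_singleton (x : X d)).subset (by simpa using ht)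

/-- `A` is a clopen neighborhood of `μ` that contains no other point of maximal rank. -/
structure IsLocalNhd (μ : X d) (A : Set (X d)) : Prop where
  isClopen : IsClopen A
  inter_M : A ∩ M d = {μ}

namespace IsLocalNhd

variable {μ : X d} {A : Set (X d)}

theorem mem (h : IsLocalNhd μ A) : μ ∈ A :=
  (h.inter_M.symm.subset rfl : μ ∈ A ∩ M d).1

theorem mem_M (h : IsLocalNhd μ A) : μ ∈ M d :=
  (h.inter_M.symm.subset rfl : μ ∈ A ∩ M d).2

theorem eq_of_mem (h : IsLocalNhd μ A) {ν : X d} (hA : ν ∈ A) (hM : ν ∈ M d) : ν = μ :=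
  h.inter_M.subset ⟨hA, hM⟩

theorem disjoint_M (h : IsLocalNhd μ A) : Disjoint (A \ {μ}) (M d) :=
  Set.disjoint_left.2 fun _ hx hM => hx.2 (h.eq_of_mem hx.1 hM)

theorem finite_diff (h : IsLocalNhd μ A) {U : Set (X d)} (hU : IsOpen U) (hμ : μ ∈ U) :
    (A \ U).Finite :=
  finite_of_isClosed (h.isClopen.1.sdiff hU)
    (h.disjoint_M.mono_left (Set.sdiff_subset_sdiff_right (Set.singleton_subset_iff.2 hμ)))

theorem union (h : IsLocalNhd μ A) {T : Set (X d)} (hT : T.Finite) (hTM : Disjoint T (M d)) :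
    IsLocalNhd μ (A ∪ T) where
  isClopen := h.isClopen.union ⟨hT.isClosed, isOpen_of_disjoint_M hTM⟩
  inter_M := by
    rw [Set.union_inter_distrib_right, h.inter_M, hTM.inter_eq, Set.union_empty]

theorem infinite (h : IsLocalNhd μ A) : (A \ {μ}).Infinite := fun hfin => by
  have h1 : IsOpen (A \ (A \ {μ})) := h.isClopen.2.sdiff hfin.isClosed
  rw [Set.sdiff_sdiff_cancel_left (Set.singleton_subset_iff.2 h.mem)] at h1
  exact isOpen_singleton_iff_notMem_M.1 h1 h.mem_M

end IsLocalNhd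

theorem exists_isLocalNhd {μ : X d} (hμ : μ ∈ M d) : ∃ A, IsLocalNhd μ A := by
  obtain ⟨U, hU, hd⟩ := (finite_M d).t2_separation
  have hM : ∀ ν ∈ U μ, ν ∈ M d → ν = μ := fun ν h1 h2 => by
    by_contra hne
    exact Set.disjoint_left.1 (hd h2 hμ hne) (hU ν).1 h1
  refine ⟨U μ, ⟨⟨⟨?_⟩, (hU μ).2⟩, ?_⟩⟩
  · have : (U μ)ᶜ = ((U μ)ᶜ \ M d) ∪ ⋃ ν ∈ M d \ {μ}, U ν := by
      ext x
      simp only [Set.mem_union, Set.mem_sdiff, Set.mem_compl_iff, Set.mem_iUnion, exists_prop,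
        Set.mem_singleton_iff]
      constructor
      · intro hx
        by_cases hxM : x ∈ M d
        · exact Or.inr ⟨x, ⟨hxM, fun h => hx (h ▸ (hU x).1)⟩, (hU x).1⟩
        · exact Or.inl ⟨hx, hxM⟩
      · rintro (h | ⟨ν, ⟨h1, h2⟩, h3⟩)
        · exact h.1
        · exact Set.disjoint_left.1 (hd h1 hμ h2) h3
    rw [this]
    exact (isOpen_of_disjoint_M Set.disjoint_sdiff_left).union
      (isOpen_biUnion fun ν _ => (hU ν).2)
  · ext ν
    exact ⟨fun h => hM ν h.1 h.2, by rintro rfl; exact ⟨(hU ν).1, hμ⟩⟩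

end Space

/-! ### Homeomorphisms near a point of maximal rank, and the closure of the finitary group. -/

section Homeomorphisms

open Equiv

variable {d : ℕ}

/-- The homeomorphism `f` is the identity near `μ`. -/
def FixesNear (f : H d) (μ : X d) : Prop :=
  ∃ U : Set (X d), IsOpen U ∧ μ ∈ U ∧ ∀ x ∈ U, f x = x

/-- The underlying permutation of a homeomorphism. -/
def toPermHom (d : ℕ) : H d →* Perm (X d) where
  toFun f := f.toEquiv
  map_one' := rfl
  map_mul' _ _ := rfl

@[simp] theorem toPermHom_apply (f : H d) (x : X d) : toPermHom d f x = f x := rfl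

theorem toPermHom_injective : Function.Injective (toPermHom d) := fun _ _ h =>
  Homeomorph.ext fun x => DFunLike.congr_fun h x

theorem FixesNear.mul {f g : H d} {μ : X d} (hf : FixesNear f μ) (hg : FixesNear g μ) :
    FixesNear (f * g) μ := by
  obtain ⟨U, hU, hμU, hfU⟩ := hf
  obtain ⟨V, hV, hμV, hgV⟩ := hg
  refine ⟨U ∩ V, hU.inter hV, ⟨hμU, hμV⟩, fun x hx => ?_⟩
  rw [Homeomorph.mul_apply, hgV x hx.2, hfU x hx.1]

theorem FixesNear.inv {f : H d} {μ : X d} (hf : FixesNear f μ) : FixesNear f⁻¹ μ := by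
  obtain ⟨U, hU, hμU, hfU⟩ := hf
  exact ⟨U, hU, hμU, fun x hx =>
    f.injective ((f.apply_symm_apply x).trans (hfU x hx).symm)⟩

theorem fixesNear_of_suppIn {f : H d} {A : Set (X d)} (hf : SuppIn (toPermHom d f) A)
    (hA : IsClosed A) {ν : X d} (hν : ν ∉ A) : FixesNear f ν :=
  ⟨Aᶜ, hA.isOpen_compl, hν, fun x hx => hf x hx⟩

theorem not_fixesNear_of_infinite {f : H d} {μ : X d} {A : Set (X d)} (hA : IsLocalNhd μ A)
    (h : {x ∈ A | f x ≠ x}.Infinite) : ¬ FixesNear f μ := by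
  rintro ⟨U, hU, hμ, hf⟩
  exact h ((hA.finite_diff hU hμ).subset fun x hx => ⟨hx.1, fun hxU => hx.2 (hf x hxU)⟩)

theorem infinite_of_not_fixesNear {f : H d} {μ : X d} {A : Set (X d)} (hA : IsLocalNhd μ A)
    (h : ¬ FixesNear f μ) (hμ : f μ = μ) : {x ∈ A \ {μ} | f x ≠ x}.Infinite := by
  intro hfin
  refine h ⟨A \ {x ∈ A \ {μ} | f x ≠ x}, hA.isClopen.2.sdiff hfin.isClosed,
    ⟨hA.mem, fun h => h.1.2 rfl⟩, fun x hx => ?_⟩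
  by_contra hne
  exact hx.2 ⟨⟨hx.1, fun e => hne (by rw [Set.mem_singleton_iff.1 e, hμ])⟩, hne⟩

theorem fixesNear_of_mem_F {f : H d} (hf : f ∈ F d) {μ : X d} (hμ : μ ∈ M d) :
    FixesNear f μ := by
  have hf : {x | x ∈ N d ∧ f x ≠ x}.Finite := hf
  obtain ⟨A, hA⟩ := exists_isLocalNhd hμ
  let U : Set (X d) := A \ {x | x ∈ N d ∧ f x ≠ x}
  have hU : IsOpen U := hA.isClopen.2.sdiff hf.isClosed
  have hμU : μ ∈ U := ⟨hA.mem, fun h => mem_N_iff.1 h.1 hμ⟩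
  have hfU : ∀ x ∈ U, x ≠ μ → f x = x := fun x hx hne => by
    by_contra h
    exact hx.2 ⟨mem_N_iff.2 fun hM => hne (hA.eq_of_mem hx.1 hM), h⟩
  refine ⟨U, hU, hμU, fun x hx => ?_⟩
  by_cases hxμ : x = μ
  · subst hxμ
    by_contra hne
    -- If `x` moved, it would be the only moved point of `U`, hence isolated.
    have ho : IsOpen (U ∩ {y | f y ≠ y}) := hU.inter (isOpen_ne_fun f.continuous continuous_id)
    have : U ∩ {y | f y ≠ y} = {x} := by
      ext y
      refine ⟨fun hy => ?_, by rintro rfl; exact ⟨hx, hne⟩⟩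
      by_contra h
      exact hy.2 (hfU y hy.1 h)
    rw [this] at ho
    exact isOpen_singleton_iff_notMem_M.1 ho hμ
  · exact hfU x hx hxμ

theorem FixesNear.apply_eq {f : H d} {μ : X d} (h : FixesNear f μ) : f μ = μ := by
  obtain ⟨U, -, hμ, hf⟩ := h
  exact hf μ hμ

theorem exists_mem_F_image_eq {f : H d} (hf : f ∈ Fbar d) {A : Set (X d)} (hA : IsClopen A) :
    ∃ s ∈ F d, s '' A = f '' A := by
  have hB : IsClopen (f '' A) := ⟨f.isClosedMap _ hA.1, f.isOpenMap _ hA.2⟩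
  obtain ⟨s, hs, hsF⟩ := mem_closure_iff.1 (show f ∈ closure (F d : Set (H d)) from hf) _
    (isOpen_basic hA hB) rfl
  exact ⟨s, hsF, hs⟩

/-- On a local neighborhood `A` of `μ`, some finitary `s` has the same image of `A` as `f`. Since
`s` fixes `f μ`, which again has maximal rank, `f μ` lies in `A` and must be `μ`. -/
theorem apply_eq_of_mem_Fbar {f : H d} (hf : f ∈ Fbar d) {μ : X d} (hμ : μ ∈ M d) :
    f μ = μ := by
  have hfμ : f μ ∈ M d := by
    by_contra h
    have h1 : IsOpen (f ⁻¹' {f μ}) := (isOpen_singleton_iff_notMem_M.2 h).preimage f.continuous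
    rw [← Set.image_singleton, f.preimage_image] at h1
    exact isOpen_singleton_iff_notMem_M.1 h1 hμ
  obtain ⟨A, hA⟩ := exists_isLocalNhd hμ
  obtain ⟨s, hs, hsA⟩ := exists_mem_F_image_eq hf hA.isClopen
  obtain ⟨y, hy, hsy⟩ : f μ ∈ s '' A := hsA ▸ ⟨μ, hA.mem, rfl⟩
  have h2 : s (f μ) = f μ := (fixesNear_of_mem_F hs hfμ).apply_eq
  have h3 : y = f μ := s.injective (hsy.trans h2.symm)
  exact hA.eq_of_mem (h3 ▸ hy) hfμ

theorem continuous_of_suppIn {μ : X d} {A : Set (X d)} (hA : IsLocalNhd μ A) {p : Perm (X d)}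
    (hp : SuppIn p (A \ {μ})) : Continuous p := by
  refine continuous_def.2 fun V hV => isOpen_iff_mem_nhds.2 fun x hx => ?_
  by_cases hxA : x ∈ A
  · by_cases hxμ : x = μ
    · subst hxμ
      have hpx : p x = x := hp x fun h => h.2 rfl
      have hxV : x ∈ V := by rw [← hpx]; exact hx
      have hfin : (p ⁻¹' (A \ V)).Finite :=
        (hA.finite_diff hV hxV).preimage p.injective.injOn
      refine Filter.mem_of_superset ((hA.isClopen.2.sdiff hfin.isClosed).mem_nhds
        ⟨hA.mem, fun h => h.2 hx⟩) fun y hy => ?_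
      by_contra hyV
      exact hy.2 ⟨(hp.mono Set.sdiff_subset).apply_mem hy.1, hyV⟩
    · exact Filter.mem_of_superset ((isOpen_singleton_iff_notMem_M.2 fun hM =>
        hxμ (hA.eq_of_mem hxA hM)).mem_nhds rfl) (Set.singleton_subset_iff.2 hx)
  · have hAV : IsOpen (Aᶜ ∩ V) := hA.isClopen.1.isOpen_compl.inter hV
    have hpA : ∀ y ∉ A, p y = y := hp.mono Set.sdiff_subset
    refine Filter.mem_of_superset (hAV.mem_nhds ⟨hxA, ?_⟩) fun y hy => ?_
    · rw [← hpA x hxA]; exact hx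
    · rw [Set.mem_preimage, hpA y hy.1]; exact hy.2

theorem exists_homeo_of_suppIn {μ : X d} {A : Set (X d)} (hA : IsLocalNhd μ A) {p : Perm (X d)}
    (hp : SuppIn p (A \ {μ})) : ∃ f : H d, toPermHom d f = p :=
  ⟨⟨p, continuous_of_suppIn hA hp, continuous_of_suppIn hA hp.inv⟩, rfl⟩

theorem mem_F_of_suppIn {f : H d} {T : Set (X d)} (hT : T.Finite)
    (hf : SuppIn (toPermHom d f) T) : f ∈ F d :=
  hT.subset fun x hx => by
    by_contra h
    exact hx.2 (hf x h)

theorem mem_Fbar_of_suppIn {μ : X d} {A : Set (X d)} (hA : IsLocalNhd μ A) {f : H d}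
    (hf : SuppIn (toPermHom d f) (A \ {μ})) : f ∈ Fbar d := by
  refine (TopologicalSpace.isTopologicalBasis_of_subbasis
    (rfl : permutationTopology d = _)).mem_closure_iff.2 ?_
  rintro _ ⟨𝒮, ⟨h𝒮fin, h𝒮⟩, rfl⟩ hf𝒮
  -- Each subbasic condition on `f` depends only on finitely many values: a clopen set or its
  -- complement misses `μ`, and whichever does meets `A` in a finite set.
  have hex : ∀ S ∈ 𝒮, ∃ E ⊆ A \ {μ}, E.Finite ∧ ∀ g : H d,
      SuppIn (toPermHom d g) (A \ {μ}) → Set.EqOn g f E → g ∈ S := by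
    intro S hS
    obtain ⟨C, D, hC, -, rfl⟩ := h𝒮 hS
    have hfD : f '' C = D := hf𝒮 _ hS
    have key : ∀ C' : Set (X d), μ ∉ C' → ∀ g : H d, SuppIn (toPermHom d g) (A \ {μ}) →
        Set.EqOn g f (C' ∩ A) → g '' C' = f '' C' := by
      intro C' hμ g hg hgf
      refine Set.image_congr fun x hx => ?_
      by_cases hxA : x ∈ A
      · exact hgf ⟨hx, hxA⟩
      · exact (hg x fun h => hxA h.1).trans (hf x fun h => hxA h.1).symm
    by_cases hμ : μ ∈ C
    · refine ⟨A \ C, fun x hx => ⟨hx.1, fun e => hx.2 (e ▸ hμ)⟩, hA.finite_diff hC.2 hμ,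
        fun g hg hgf => ?_⟩
      have h1 := key Cᶜ (fun h => h hμ) g hg (fun x hx => hgf ⟨hx.2, hx.1⟩)
      rw [Set.image_compl_eq g.bijective, Set.image_compl_eq f.bijective, compl_inj_iff] at h1
      exact h1.trans hfD
    · refine ⟨C ∩ A, fun x hx => ⟨hx.2, fun e => hμ (e ▸ hx.1)⟩, ?_, fun g hg hgf => ?_⟩
      · have := hA.finite_diff hC.compl.2 hμ
        rwa [Set.sdiff_compl, Set.inter_comm] at this
      · exact (key C hμ g hg hgf).trans hfD
  choose! E hEA hE hES using hex
  obtain ⟨q, T, hT, hTA, hqT, hqE⟩ := exists_finite_perm_eqOn (E := ⋃ S ∈ 𝒮, E S)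
    (h𝒮fin.biUnion hE) (Set.iUnion₂_subset hEA) hf
  obtain ⟨g, rfl⟩ := exists_homeo_of_suppIn hA (hqT.mono hTA)
  refine ⟨g, fun S hS => hES S hS g (hqT.mono hTA) fun x hx => hqE ?_, mem_F_of_suppIn hT hqT⟩
  exact Set.mem_biUnion hS hx

end Homeomorphisms

/-! ### Local factors, normal subgroups and uniform generation. -/

section NormalSubgroups

open Equiv

variable {d : ℕ}

/-- The homeomorphism `f` is supported on isolated points in a clopen neighborhood of `μ` without
other points of maximal rank. -/
def IsLocalAt (f : H d) (μ : X d) : Prop :=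
  ∃ A, IsLocalNhd μ A ∧ SuppIn (toPermHom d f) (A \ {μ})

theorem IsLocalAt.mem_Fbar {f : H d} {μ : X d} (h : IsLocalAt f μ) : f ∈ Fbar d := by
  obtain ⟨A, hA, hf⟩ := h
  exact mem_Fbar_of_suppIn hA hf

theorem IsLocalAt.fixesNear {f : H d} {μ ν : X d} (h : IsLocalAt f μ) (hν : ν ∈ M d)
    (hne : ν ≠ μ) : FixesNear f ν := by
  obtain ⟨A, hA, hf⟩ := h
  exact fixesNear_of_suppIn (hf.mono Set.sdiff_subset) hA.isClopen.1
    fun h => hne (hA.eq_of_mem h hν)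

/-- With `s` finitary and `s '' A = f '' A`, the map `s⁻¹ * f` preserves `A`. Its restriction to `A`
is the local factor `σ`, and `f * σ⁻¹` agrees near `μ` with `s`, hence with the identity. -/
theorem exists_isLocalAt_fixesNear_mul_inv {f : H d} (hf : f ∈ Fbar d) {μ : X d}
    (hμ : μ ∈ M d) : ∃ σ : H d, IsLocalAt σ μ ∧ FixesNear (f * σ⁻¹) μ := by
  classical
  obtain ⟨A, hA⟩ := exists_isLocalNhd hμ
  obtain ⟨s, hs, hsA⟩ := exists_mem_F_image_eq hf hA.isClopen
  have hsμ := fixesNear_of_mem_F hs hμ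
  let g : Perm (X d) := toPermHom d (s⁻¹ * f)
  have hsg : ∀ x, s (g x) = f x := fun x => s.apply_symm_apply (f x)
  have hg : ∀ x, g x ∈ A ↔ x ∈ A := by
    intro x
    rw [← f.injective.mem_set_image (s := A) (a := x), ← hsA, ← hsg x, s.injective.mem_set_image]
  let p : Perm (X d) := Perm.ofSubtype (g.subtypePerm (p := (· ∈ A)) hg)
  have hpA : ∀ x ∈ A, p x = g x := fun x hx => Perm.ofSubtype_apply_of_mem _ hx
  have hpμ : p μ = μ := by
    rw [hpA μ hA.mem]
    apply s.injective
    rw [hsg, apply_eq_of_mem_Fbar hf hμ, hsμ.apply_eq]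
  have hp : SuppIn p (A \ {μ}) := by
    intro x hx
    by_cases hxA : x ∈ A
    · have : x = μ := by by_contra h; exact hx ⟨hxA, h⟩
      rw [this, hpμ]
    · exact Perm.ofSubtype_apply_of_not_mem _ hxA
  obtain ⟨σ, hσ⟩ := exists_homeo_of_suppIn hA hp
  refine ⟨σ, ⟨A, hA, hσ ▸ hp⟩, ?_⟩
  obtain ⟨U, hU, hμU, hsU⟩ := hsμ
  refine ⟨U ∩ A, hU.inter hA.isClopen.2, ⟨hμU, hA.mem⟩, fun x hx => ?_⟩
  have hy : p⁻¹ x ∈ A := (hp.mono Set.sdiff_subset).inv.apply_mem hx.2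
  have hσx : σ⁻¹ x = p⁻¹ x := by
    rw [← hσ, ← map_inv]; rfl
  rw [Homeomorph.mul_apply, hσx, ← hsg, ← hpA _ hy]
  have : p (p⁻¹ x) = x := p.apply_symm_apply x
  rw [this, hsU x hx.1]

theorem finite_of_forall_fixesNear {f : H d} (hf : ∀ ν ∈ M d, FixesNear f ν) :
    {x | f x ≠ x}.Finite := by
  choose! U hU hνU hfU using hf
  refine (finite_of_isClosed (isOpen_biUnion hU).isClosed_compl
    (Set.disjoint_right.2 fun ν hν h => h (Set.mem_biUnion hν (hνU ν hν)))).subset ?_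
  intro x hx h
  obtain ⟨ν, hν, hx'⟩ := Set.mem_iUnion₂.1 h
  exact hx (hfU ν hν x hx')

/-- The finitely many moved points are isolated and can be adjoined to a local neighborhood of any
`μ`. A finitary remainder can thus be charged to whichever `μ` is convenient. -/
theorem isLocalAt_of_forall_fixesNear {f : H d} (hf : ∀ ν ∈ M d, FixesNear f ν) {μ : X d}
    (hμ : μ ∈ M d) : IsLocalAt f μ := by
  have hdisj : Disjoint {x | f x ≠ x} (M d) :=
    Set.disjoint_right.2 fun ν hν h => h (hf ν hν).apply_eq
  obtain ⟨A, hA⟩ := exists_isLocalNhd hμ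
  refine ⟨_, hA.union (finite_of_forall_fixesNear hf) hdisj, fun x hx => ?_⟩
  by_contra h
  exact hx ⟨Or.inr h, fun e => Set.disjoint_left.1 hdisj h (by rwa [Set.mem_singleton_iff.1 e])⟩

/-- Elements of `Fbar d` decompose into boundedly many local ones, in the form of an induction
principle. -/
theorem induction_isLocalAt (P : ℕ → H d → Prop)
    (hmul : ∀ k m x y, P k x → P m y → P (k + m) (x * y)) (k : ℕ) {μ₀ : X d} (hμ₀ : μ₀ ∈ M d)
    (h₀ : ∀ y, IsLocalAt y μ₀ → P k y) (T : Finset (X d)) (hTM : ∀ μ ∈ T, μ ∈ M d)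
    (hT : ∀ μ ∈ T, ∀ y, IsLocalAt y μ → P k y) (f : H d) (hf : f ∈ Fbar d)
    (hfT : ∀ ν ∈ M d, ν ∉ T → FixesNear f ν) : P (k * (T.card + 1)) f := by
  classical
  induction T using Finset.induction_on generalizing f with
  | empty =>
    -- The extra `1` in `T.card + 1` pays for this remainder, treated as local at `μ₀`.
    simpa using h₀ f (isLocalAt_of_forall_fixesNear (fun ν hν => hfT ν hν (by simp)) hμ₀)
  | insert μ T hμT ih =>
    have hμ := hTM μ (by simp)
    obtain ⟨σ, hσ, hfσ⟩ := exists_isLocalAt_fixesNear_mul_inv hf hμ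
    have h1 := ih (fun ν hν => hTM ν (by simp [hν])) (fun ν hν => hT ν (by simp [hν])) (f * σ⁻¹)
      (mul_mem hf (inv_mem hσ.mem_Fbar)) fun ν hν hνT => by
        by_cases hνμ : ν = μ
        · rwa [hνμ]
        · exact (hfT ν hν (by simp [hνμ, hνT])).mul (hσ.fixesNear hν hνμ).inv
    have h2 := hmul _ _ _ _ h1 (hT μ (by simp) σ hσ)
    rw [inv_mul_cancel_right] at h2
    rw [Finset.card_insert_of_notMem hμT]
    exact h2

theorem exists_isLocalAt_not_fixesNear {μ : X d} (hμ : μ ∈ M d) :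
    ∃ f : H d, IsLocalAt f μ ∧ ¬ FixesNear f μ := by
  obtain ⟨A, hA⟩ := exists_isLocalNhd hμ
  obtain ⟨eq⟩ : Nonempty (ℤ ≃ ℕ) := nonempty_equiv_of_countable
  let e : ℤ ↪ X d :=
    (eq.toEmbedding.trans hA.infinite.natEmbedding).trans (Function.Embedding.subtype _)
  have he : Set.range e ⊆ A \ {μ} := by
    rintro _ ⟨n, rfl⟩; exact (hA.infinite.natEmbedding _ _).2
  have hp := suppIn_viaEmbedding (Equiv.addRight (1 : ℤ)) e he
  obtain ⟨f, hf⟩ := exists_homeo_of_suppIn hA hp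
  refine ⟨f, ⟨A, hA, hf ▸ hp⟩, not_fixesNear_of_infinite hA
    ((Set.infinite_range_of_injective e.injective).mono ?_)⟩
  rintro _ ⟨n, rfl⟩
  refine ⟨(he ⟨n, rfl⟩).1, ?_⟩
  rw [← toPermHom_apply, hf, Perm.viaEmbedding_apply]
  exact fun h => by simpa using e.injective h

theorem exists_mem_Fbar_fixesNear_iff (T : Finset (X d)) (hTM : ∀ μ ∈ T, μ ∈ M d) :
    ∃ f ∈ Fbar d, ∀ ν ∈ M d, FixesNear f ν ↔ ν ∉ T := by
  classical
  induction T using Finset.induction_on with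
  | empty => exact ⟨1, one_mem _, fun ν _ => by
      simpa using ⟨Set.univ, isOpen_univ, trivial, fun _ _ => rfl⟩⟩
  | insert μ T hμT ih =>
    obtain ⟨f, hf, hfT⟩ := ih fun ν hν => hTM ν (by simp [hν])
    have hμ := hTM μ (by simp)
    obtain ⟨σ, hσ, hσμ⟩ := exists_isLocalAt_not_fixesNear hμ
    refine ⟨f * σ, mul_mem hf hσ.mem_Fbar, fun ν hν => ?_⟩
    by_cases hνμ : ν = μ
    · subst hνμ
      refine iff_of_false (fun h => hσμ ?_) (by simp)
      simpa using ((hfT ν hν).2 hμT).inv.mul h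
    · have hσν := hσ.fixesNear hν hνμ
      simp only [Finset.mem_insert, hνμ, false_or, ← hfT ν hν]
      exact ⟨fun h => by simpa using h.mul hσν.inv, fun h => h.mul hσν⟩

/-- In a group of homeomorphisms containing everything local at `μ`, an element that is not the
identity near its fixed point `μ` generates everything local at `μ` by eight conjugates. -/
theorem conjProd_of_isLocalAt {G : Type*} [Group G] (ι : G →* H d) (hι : Function.Injective ι)
    {μ : X d} (hsurj : ∀ f : H d, IsLocalAt f μ → ∃ x, ι x = f) (g : G) (hgμ : ι g μ = μ)
    (hg : ¬ FixesNear (ι g) μ) (x : G) (hx : IsLocalAt (ι x) μ) : ConjProd g 8 x := by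
  obtain ⟨A, hA, hxA⟩ := hx
  have : Countable (X d) := countable_X d
  refine conjProd_of_suppIn ((toPermHom d).comp ι) (toPermHom_injective.comp hι)
    (A \ {μ}).to_countable (fun p hp => ?_) g (infinite_of_not_fixesNear hA hg hgμ) x hxA
  obtain ⟨f, rfl⟩ := exists_homeo_of_suppIn hA hp
  obtain ⟨y, rfl⟩ := hsurj f ⟨A, hA, hp⟩
  exact ⟨y, rfl⟩

theorem mem_FZ_iff {Z : Set (X d)} {f : Fbar d} :
    f ∈ FZ Z ↔ ∀ μ ∈ Z, FixesNear (f : H d) μ := Iff.rfl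

theorem mem_ZΓ_iff {Γ : Subgroup (Fbar d)} {μ : X d} :
    μ ∈ ZΓ Γ ↔ μ ∈ M d ∧ ∀ g ∈ Γ, FixesNear (g : H d) μ := Iff.rfl

theorem mem_ZΓ_zpowers_iff {γ : Fbar d} {μ : X d} :
    μ ∈ ZΓ (Subgroup.zpowers γ) ↔ μ ∈ M d ∧ FixesNear (γ : H d) μ := by
  rw [mem_ZΓ_iff]
  refine and_congr_right fun _ => ⟨fun h => h γ (Subgroup.mem_zpowers γ), fun h => ?_⟩
  have hle : Subgroup.zpowers γ ≤ FZ {μ} :=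
    Subgroup.zpowers_le.2 (mem_FZ_iff.2 (by rintro _ rfl; exact h))
  exact fun g hg => mem_FZ_iff.1 (hle hg) μ rfl

theorem le_FZ_ZΓ (Γ : Subgroup (Fbar d)) : Γ ≤ FZ (ZΓ Γ) := fun g hg _ hμ => hμ.2 g hg

theorem exists_mem_M_notMem_ZΓ {Γ : Subgroup (Fbar d)} (hΓ : ¬ Γ ≤ (F d).subgroupOf (Fbar d)) :
    ∃ μ ∈ M d, μ ∉ ZΓ Γ := by
  by_contra! hcon
  refine hΓ fun g hg => Subgroup.mem_subgroupOf.2 ?_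
  exact (finite_of_forall_fixesNear fun ν hν => (hcon ν hν).2 g hg).subset fun x hx => hx.2

theorem exists_finset_eq_M_diff (Z : Set (X d)) :
    ∃ T : Finset (X d), ∀ μ, μ ∈ T ↔ μ ∈ M d ∧ μ ∉ Z :=
  ⟨((finite_M d).sdiff (t := Z)).toFinset, fun μ => by simp⟩

theorem FZ_ZΓ_eq {Γ : Subgroup (Fbar d)} (hN : Γ.Normal)
    (hΓ : ¬ Γ ≤ (F d).subgroupOf (Fbar d)) : FZ (ZΓ Γ) = Γ := by
  refine le_antisymm (fun f hf => ?_) (le_FZ_ZΓ Γ)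
  obtain ⟨μ₀, hμ₀, hμ₀Z⟩ := exists_mem_M_notMem_ZΓ hΓ
  obtain ⟨T, hT⟩ := exists_finset_eq_M_diff (ZΓ Γ)
  have hloc : ∀ μ ∈ T, ∀ y, IsLocalAt y μ → y ∈ Γ.map (Fbar d).subtype := by
    intro μ hμ y hy
    obtain ⟨hμM, hμZ⟩ := (hT μ).1 hμ
    obtain ⟨g, hg, hgμ⟩ : ∃ g ∈ Γ, ¬ FixesNear (g : H d) μ := by
      by_contra! h
      exact hμZ ⟨hμM, h⟩
    exact ⟨⟨y, hy.mem_Fbar⟩, (conjProd_of_isLocalAt (Fbar d).subtype Subtype.val_injective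
      (fun f hf => ⟨⟨f, hf.mem_Fbar⟩, rfl⟩) g (apply_eq_of_mem_Fbar g.2 hμM) hgμ
      ⟨y, hy.mem_Fbar⟩ hy).mem_of_normal hN hg, rfl⟩
  -- Only membership matters here, so the predicate ignores the count and `0` is a dummy value.
  have key := induction_isLocalAt (fun _ x => x ∈ Γ.map (Fbar d).subtype)
    (fun _ _ _ _ hx hy => mul_mem hx hy) 0 hμ₀ (hloc μ₀ ((hT μ₀).2 ⟨hμ₀, hμ₀Z⟩)) T
    (fun μ hμ => ((hT μ).1 hμ).1) hloc f f.2
    (fun ν hν hνT => hf ν (by by_contra h; exact hνT ((hT ν).2 ⟨hν, h⟩)))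
  obtain ⟨y, hy, hyf⟩ := key
  rwa [← Subtype.ext hyf]

theorem exists_mem_ZΓ_zpowers_eq {Γ : Subgroup (Fbar d)} (h : FZ (ZΓ Γ) = Γ) :
    ∃ γ ∈ Γ, ZΓ (Subgroup.zpowers γ) = ZΓ Γ := by
  obtain ⟨T, hT⟩ := exists_finset_eq_M_diff (ZΓ Γ)
  obtain ⟨f, hf, hfT⟩ := exists_mem_Fbar_fixesNear_iff T fun μ hμ => ((hT μ).1 hμ).1
  refine ⟨⟨f, hf⟩, ?_, ?_⟩
  · rw [← h]
    exact fun μ hμ => (hfT μ hμ.1).2 fun hμT => ((hT μ).1 hμT).2 hμ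
  · ext μ
    rw [mem_ZΓ_zpowers_iff]
    constructor
    · rintro ⟨hμ, hfμ⟩
      by_contra hμZ
      exact (hfT μ hμ).1 hfμ ((hT μ).2 ⟨hμ, hμZ⟩)
    · exact fun hμ => ⟨hμ.1, (hfT μ hμ.1).2 fun hμT => ((hT μ).1 hμT).2 hμ⟩

theorem uniformlyNormallyGenerates_of_ZΓ_eq {Γ : Subgroup (Fbar d)} (h : FZ (ZΓ Γ) = Γ)
    (hΓ : ¬ Γ ≤ (F d).subgroupOf (Fbar d)) {γ : Fbar d} (hγ : γ ∈ Γ)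
    (hZ : ZΓ (Subgroup.zpowers γ) = ZΓ Γ) : UniformlyNormallyGenerates (⟨γ, hγ⟩ : Γ) := by
  obtain ⟨μ₀, hμ₀, hμ₀Z⟩ := exists_mem_M_notMem_ZΓ hΓ
  obtain ⟨T, hT⟩ := exists_finset_eq_M_diff (ZΓ Γ)
  -- The conjugators must lie in `Γ`, so `conjProd_of_isLocalAt` is applied to `Γ` itself. This
  -- works because `Γ`, being `FZ (ZΓ Γ)`, contains everything local at points of `T`.
  let ι : Γ →* H d := (Fbar d).subtype.comp Γ.subtype
  have hι : Function.Injective ι := Subtype.val_injective.comp Subtype.val_injective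
  have hlift : ∀ μ ∈ T, ∀ f : H d, IsLocalAt f μ → ∃ x, ι x = f := by
    intro μ hμ f hf
    refine ⟨⟨⟨f, hf.mem_Fbar⟩, ?_⟩, rfl⟩
    rw [← h]
    exact fun ν hν => hf.fixesNear hν.1 fun e => ((hT μ).1 hμ).2 (e ▸ hν)
  have hloc : ∀ μ ∈ T, ∀ y, IsLocalAt y μ →
      ∃ x : Γ, ι x = y ∧ ConjProd (⟨γ, hγ⟩ : Γ) 8 x := by
    intro μ hμ y hy
    obtain ⟨hμM, hμZ⟩ := (hT μ).1 hμ
    obtain ⟨x, rfl⟩ := hlift μ hμ y hy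
    refine ⟨x, rfl, conjProd_of_isLocalAt ι hι (hlift μ hμ) _ (apply_eq_of_mem_Fbar γ.2 hμM)
      (fun hfix => hμZ ?_) x hy⟩
    rw [← hZ, mem_ZΓ_zpowers_iff]
    exact ⟨hμM, hfix⟩
  refine ⟨8 * (T.card + 1), fun x => ?_⟩
  obtain ⟨y, hyx, hy⟩ := induction_isLocalAt
    (fun k f => ∃ x : Γ, ι x = f ∧ ConjProd (⟨γ, hγ⟩ : Γ) k x)
    (by
      rintro k m _ _ ⟨x, rfl, hx⟩ ⟨y, rfl, hy⟩
      exact ⟨x * y, map_mul _ _ _, hx.mul hy⟩) 8 hμ₀ (hloc μ₀ ((hT μ₀).2 ⟨hμ₀, hμ₀Z⟩)) T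
    (fun μ hμ => ((hT μ).1 hμ).1) hloc (ι x) x.1.2
    (fun ν hν hνT => le_FZ_ZΓ Γ x.2 ν (by by_contra h; exact hνT ((hT ν).2 ⟨hν, h⟩)))
  rw [← hι hyx]
  exact hy

end NormalSubgroups

end OrdHomeo

theorem mainTheorem9 (d : ℕ) (hd : 2 ≤ d) (Γ : Subgroup (OrdHomeo.Fbar d)) (hN : Γ.Normal)
    (hΓ : ¬ Γ ≤ (OrdHomeo.F d).subgroupOf (OrdHomeo.Fbar d)) :
    OrdHomeo.FZ (OrdHomeo.ZΓ Γ) = Γ ∧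
    (∃ γ ∈ Γ, OrdHomeo.ZΓ (Subgroup.zpowers γ) = OrdHomeo.ZΓ Γ) ∧
    (∀ (γ : OrdHomeo.Fbar d) (hγ : γ ∈ Γ),
      OrdHomeo.ZΓ (Subgroup.zpowers γ) = OrdHomeo.ZΓ Γ →
        OrdHomeo.UniformlyNormallyGenerates (⟨γ, hγ⟩ : Γ)) := by
  have h := OrdHomeo.FZ_ZΓ_eq hN hΓ
  exact ⟨h, OrdHomeo.exists_mem_ZΓ_zpowers_eq h,
    fun _ hγ hZ => OrdHomeo.uniformlyNormallyGenerates_of_ZΓ_eq h hΓ hγ hZ⟩
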